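/- Single-sample OSO (Online Sampling Optimization) can do unboundedly better than the myopic policy. Setting. In online resource allocation, items $t=1,\dots,T$ arrive one at a time with i.i.d. parameters $\xi^t=(r^t,A^t)\sim\mathcal D$. Each item must irrevocably be rejected or assigned to one supply node $j$; the assignment yields reward $r^t_j$ and consumes $A^t_{jk}$ units of each resource $k$, whose total capacity is $b_k$. The value $\mathrm{OPT}$ is the optimal total reward when all items are known in advance. In each period $t$, single-sample OSO observes $\xi^t$, draws one fresh sample path of future items, independently from $\mathcal D$, solves to optimality the offline integer program made of item $t$ and the sampled items with the remaining capacities, implements its decision on item $t$, and discards the rest. The myopic policy chooses in each period a decision that maximizes the immediate reward subject to the remaining capacities. The integer programs are solved by a (possibly randomized) solver that always returns an optimal solution. The solver used by OSO is equivariant: permuting the items permutes the (law of the) returned solution accordingly; fresh, independent solver randomness is used in each period. Example. For $0<\varphi<1$ and $T\ge1$, let $I_{\varphi,T}$ be the instance with one supply node, one resource of capacity $\sqrt T$, and $T$ items of size $1$ with i.i.d. values equal to $1$ with probability $1/\sqrt T$ and to $\varphi$ with probability $1-1/\sqrt T$. Let $\mathrm{OSO}$ and $\mathrm{Myo}$ denote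 the total rewards of single-sample OSO and of the myopic policy on $I_{\varphi,T}$. Then: 1. (Unbounded benefit.) For every $M\in\mathbb R$ there is $\varphi_0\in(0,1]$ such that for every $\varphi\in(0,\varphi_0)$ there is $T_0$ such that for all $T\ge T_0$, whatever the solvers used, $\mathbb E[\mathrm{Myo}]>0$ and $\mathbb E[\mathrm{OSO}]\ge M\cdot\mathbb E[\mathrm{Myo}]$. 2. (OSO.) For every $\varepsilon>0$ there is $T_0$ such that for all $T\ge T_0$, all $\varphi\in(0,1)$ and every equivariant solver, $\mathbb E[\mathrm{OSO}]\ge(1-\varepsilon)\,\mathbb E[\mathrm{OPT}]$. 3. (Optimum.) For every $\varphi\in(0,1)$, $\mathbb E[\mathrm{OPT}]/\sqrt T\to1$ as $T\to\infty$. 4. (Myopic policy.) For every $\varphi\in(0,1)$ and every $T$, whatever the solver, $\mathbb E[\mathrm{Myo}]=\lfloor\sqrt T\rfloor\left(1\cdot\tfrac1{\sqrt T}+\varphi\left(1-\tfrac1{\sqrt T}\right)\right)$, which is $\varphi\sqrt T+1-\varphi$ if $T$ is a perfect square; and $\mathbb E[\mathrm{Myo}]/\mathbb E[\mathrm{OPT}]\to\varphi$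 as $T\to\infty$. -/

import Mathlib

open scoped NNReal ENNReal

namespace OnlineAllocation

noncomputable section

/-- The parameters `ξ = (r, A)` of one demand item, for supply nodes `J` and resources `K`:
assigning the item to supply node `j` yields `reward j` and consumes `size j k` units of
resource `k`. -/
@[ext]
structure Item (J K : Type) where
  /-- the rewards `r j` -/
  reward : J → ℝ
  /-- the resource requirements `A j k` -/
  size : J → K → ℝ

section Offline

variable {J K : Type}

/-- Reward of a decision about one item. A decision is an element of `Option J`: `some j` assigns
the item to supply node `j`, and `none` rejects it. (These are exactly the binary vectors
`x : J → {0, 1}` with `∑ j, x j ≤ 1`.) -/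
def Item.gain (a : Item J K) : Option J → ℝ
  | none => 0
  | some j => a.reward j

/-- Resource consumption of a decision about one item. -/
def Item.consumption (a : Item J K) : Option J → K → ℝ
  | none => fun _ => 0
  | some j => a.size j

/-- The decisions `x` about the items `a 0, …, a (n - 1)` respect the resource capacities `b`. -/
def Feasible {n : ℕ} (a : Fin n → Item J K) (b : K → ℝ) (x : Fin n → Option J) : Prop :=
  ∀ k, ∑ i, (a i).consumption (x i) k ≤ b k

/-- Total reward of the decisions `x` about the items `a 0, …, a (n - 1)`. -/
def planReward {n : ℕ} (a : Fin n → Item J K) (x : Fin n → Option J) : ℝ :=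
  ∑ i, (a i).gain (x i)

/-- `x` is an optimal solution of the offline integer program with items `a` and capacities `b`. -/
def IsOptimal {n : ℕ} (a : Fin n → Item J K) (b : K → ℝ) (x : Fin n → Option J) : Prop :=
  Feasible a b x ∧ ∀ y, Feasible a b y → planReward a y ≤ planReward a x

/-- The optimal value of the offline integer program (a maximum over finitely many plans,
attained whenever some plan is feasible). -/
def offlineOpt {n : ℕ} (a : Fin n → Item J K) (b : K → ℝ) : ℝ :=
  sSup {v | ∃ x, Feasible a b x ∧ planReward a x = v}

end Offline

/-- A (possibly randomized) integer program solver: given the items and the capacities of an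
offline integer program, it returns a random plan which is always an optimal solution if the
program is feasible. The randomness only serves to choose among several optimal solutions. -/
structure Solver (J K : Type) where
  /-- the law of the returned plan -/
  solve : (n : ℕ) → (Fin n → Item J K) → (K → ℝ) → PMF (Fin n → Option J)
  optimal : ∀ (n : ℕ) (a : Fin n → Item J K) (b : K → ℝ), (∃ x, Feasible a b x) →
    ∀ x ∈ (solve n a b).support, IsOptimal a b x

/-- A solver is equivariant if permuting the items permutes its (random) solution in the same
way. -/
def Solver.Equivariant {J K : Type} (σ : Solver J K) : Prop :=
  ∀ (n : ℕ) (a : Fin n → Item J K) (b : K → ℝ) (π : Equiv.Perm (Fin n)),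
    σ.solve n (a ∘ π) b = (σ.solve n a b).map (fun x => x ∘ π)

/-- A uniformly random optimal solution is the output of an equivariant solver; so such solvers
exist. -/
theorem exists_equivariant_solver (J K : Type) [Finite J] :
    ∃ σ : Solver J K, σ.Equivariant := by
  classical
  have _ := Fintype.ofFinite J
  let S : (n : ℕ) → (Fin n → Item J K) → (K → ℝ) → Finset (Fin n → Option J) :=
    fun n a b => Finset.univ.filter fun x => IsOptimal a b x
  have hS : ∀ n a b x, x ∈ S n a b ↔ IsOptimal a b x := fun n a b x => by simp [S]
  have hne : ∀ n a b, (∃ x, Feasible a b x) → (S n a b).Nonempty := by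
    rintro n a b ⟨x, hx⟩
    obtain ⟨y, hy, hmax⟩ := Finset.exists_max_image
      (Finset.univ.filter fun x => Feasible a b x) (planReward a) ⟨x, by simpa using hx⟩
    refine ⟨y, (hS _ _ _ _).2 ⟨by simpa using hy, fun z hz => hmax z (by simpa using hz)⟩⟩
  let f : (n : ℕ) → (Fin n → Item J K) → (K → ℝ) → PMF (Fin n → Option J) := fun n a b =>
    if h : (S n a b).Nonempty then PMF.uniformOfFinset (S n a b) h
    else PMF.pure fun _ => none
  refine ⟨⟨f, fun n a b hx x hxs => ?_⟩, fun n a b π => ?_⟩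
  · simp only [f, dif_pos (hne n a b hx)] at hxs
    rw [PMF.mem_support_uniformOfFinset_iff] at hxs
    exact (hS _ _ _ _).1 hxs
  · have hfe : ∀ x : Fin n → Option J, Feasible (a ∘ π) b (x ∘ π) ↔ Feasible a b x := fun x =>
      forall_congr' fun k => by
        simp only [Function.comp_apply]
        rw [Equiv.sum_comp π fun i => (a i).consumption (x i) k]
    have hre : ∀ x : Fin n → Option J, planReward (a ∘ π) (x ∘ π) = planReward a x := fun x =>
      Equiv.sum_comp π fun i => (a i).gain (x i)
    have hop : ∀ x : Fin n → Option J, IsOptimal (a ∘ π) b (x ∘ π) ↔ IsOptimal a b x := by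
      intro x
      unfold IsOptimal
      rw [hfe, hre]
      refine and_congr_right fun _ => ⟨fun h y hy => ?_, fun h y hy => ?_⟩
      · rw [← hre y]
        exact h _ ((hfe y).2 hy)
      · have e : y = (y ∘ π.symm) ∘ π := by ext; simp
        rw [e] at hy ⊢
        rw [hre]
        exact h _ ((hfe _).1 hy)
    have hmem : ∀ x : Fin n → Option J, x ∘ π ∈ S n (a ∘ π) b ↔ x ∈ S n a b := fun x => by
      rw [hS, hS, hop]
    have himg : S n (a ∘ π) b = (S n a b).image fun x => x ∘ π := by
      ext y
      have e : y = (y ∘ π.symm) ∘ π := by ext; simp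
      rw [Finset.mem_image]
      refine ⟨fun hy => ⟨y ∘ π.symm, ?_, e.symm⟩, ?_⟩
      · rw [e] at hy
        exact (hmem _).1 hy
      · rintro ⟨x, hx, rfl⟩
        exact (hmem x).2 hx
    have hinj : Function.Injective fun x : Fin n → Option J => x ∘ π := fun x y h =>
      π.surjective.injective_comp_right h
    have hcard : (S n (a ∘ π) b).card = (S n a b).card := by
      rw [himg, Finset.card_image_of_injective _ hinj]
    change f n (a ∘ π) b = (f n a b).map fun x => x ∘ π
    by_cases h : (S n a b).Nonempty
    · have h' : (S n (a ∘ π) b).Nonempty := by rw [himg]; exact h.image _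
      simp only [f, dif_pos h, dif_pos h']
      ext y
      have e : y = (y ∘ π.symm) ∘ π := by ext; simp
      rw [PMF.map_apply, tsum_eq_single (y ∘ π.symm)]
      · rw [if_pos e, PMF.uniformOfFinset_apply, PMF.uniformOfFinset_apply, hcard]
        have := hmem (y ∘ π.symm)
        rw [← e] at this
        by_cases hy : y ∘ π.symm ∈ S n a b
        · rw [if_pos hy, if_pos (this.2 hy)]
        · rw [if_neg hy, if_neg (mt this.1 hy)]
      · intro x hx
        rw [if_neg]
        rintro rfl
        exact hx (by ext; simp)
    · have h' : ¬ (S n (a ∘ π) b).Nonempty := by rw [himg]; simpa using h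
      simp only [f, dif_neg h, dif_neg h', PMF.pure_map]
      rfl

/-- The law of `n` independent samples from `D`. -/
def iid {α : Type} (D : PMF α) : (n : ℕ) → PMF (Fin n → α)
  | 0 => PMF.pure Fin.elim0
  | n + 1 => D.bind fun a => (iid D n).bind fun s => PMF.pure (Fin.cons a s)

/-- The mean of a discrete law on `ℝ`. -/
def mean (p : PMF ℝ) : ℝ := ∫ v, v ∂p.toMeasure

/-- A (possibly randomized) online policy. Its arguments are the number of periods that follow the
current one, the remaining capacities, i.e. the initial ones minus what the past decisions have
consumed, and the observed current item; it returns the law of the current decision. -/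
abbrev Policy (J K : Type) := ℕ → (K → ℝ) → Item J K → PMF (Option J)

/-- Single-sample OSO: draw one fresh sample path of the future items, solve the offline problem
made of the current item (at index `0`) and of the sampled items with the remaining capacities,
implement the decision about the current item, and discard the rest. -/
def oso {J K : Type} (σ : Solver J K) (D : PMF (Item J K)) : Policy J K := fun m b ξ =>
  (iid D m).bind fun s => (σ.solve (m + 1) (Fin.cons ξ s) b).map fun x => x 0

/-- The myopic policy: optimize the immediate decision only, subject to the remaining
capacities. -/
def myopic {J K : Type} (σ : Solver J K) : Policy J K := fun _ b ξ =>
  (σ.solve 1 (fun _ => ξ) b).map fun x => x 0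

/-- An instance of online resource allocation with supply nodes `J` and resources `K`: items
arrive one at a time, and their parameters are independent draws from a discrete law. -/
structure Problem (J K : Type) where
  /-- the number of periods `T` -/
  horizon : ℕ
  /-- the law `𝓓` of one item -/
  law : PMF (Item J K)
  /-- the capacities of the resources -/
  capacity : K → ℝ

/-- The law of the total reward that a policy collects during `n` remaining periods with remaining
capacities `b`: in each period an item is drawn, the policy decides about it, its consumption is
deducted from the capacities. -/
def rewardLaw {J K : Type} (D : PMF (Item J K)) (P : Policy J K) : ℕ → (K → ℝ) → PMF ℝ
  | 0, _ => PMF.pure 0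
  | m + 1, b => D.bind fun ξ => (P m b ξ).bind fun x =>
      (rewardLaw D P m (fun k => b k - ξ.consumption x k)).map fun v => ξ.gain x + v

namespace Problem

variable {J K : Type} (I : Problem J K)

/-- Expected total reward of single-sample OSO. -/
def expectedOSO (σ : Solver J K) : ℝ :=
  mean (rewardLaw I.law (oso σ I.law) I.horizon I.capacity)

/-- Expected total reward of the myopic policy. -/
def expectedMyopic (σ : Solver J K) : ℝ :=
  mean (rewardLaw I.law (myopic σ) I.horizon I.capacity)

/-- Expected perfect-information (hindsight) optimum. -/
def expectedOPT : ℝ :=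
  mean ((iid I.law I.horizon).map fun a => offlineOpt a I.capacity)

end Problem

/-- The item of value `r` and size `1`, with one supply node and one resource. -/
def unitItem (r : ℝ) : Item Unit Unit where
  reward _ := r
  size _ _ := 1

/-- The number `1 / √T` is at most one (for `T = 0` it is `0`). -/
theorem one_div_sqrt_le_one (T : ℕ) : 1 / NNReal.sqrt (T : ℝ≥0) ≤ 1 := by
  rcases Nat.eq_zero_or_pos T with rfl | h
  · simp
  · have h1 : (1 : ℝ≥0) ≤ NNReal.sqrt (T : ℝ≥0) := by
      rw [← NNReal.sqrt_one]
      exact NNReal.sqrt_le_sqrt.mpr (by exact_mod_cast h)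
    exact div_le_one_of_le₀ h1 zero_le

/-- The law on two outcomes which gives `true` the probability `p` and `false` the probability
`1 - p`. -/
def coin (p : ℝ≥0) (hp : p ≤ 1) : PMF Bool :=
  PMF.ofFintype (fun c => cond c (p : ℝ≥0∞) (1 - p : ℝ≥0)) (by
    rw [Fintype.sum_bool]
    simp only [cond_true, cond_false]
    rw [← ENNReal.coe_add, add_tsub_cancel_of_le hp, ENNReal.coe_one])

/-- The example: one supply node, one resource of capacity `√T`, and `T` items of size `1` whose
values are independently `1` with probability `1 / √T` and `φ` with probability `1 - 1 / √T`. -/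
def example₁ (φ : ℝ) (T : ℕ) : Problem Unit Unit where
  horizon := T
  law := (coin (1 / NNReal.sqrt (T : ℝ≥0)) (one_div_sqrt_le_one T)).map
    fun c => unitItem (cond c 1 φ)
  capacity _ := Real.sqrt T

end

end OnlineAllocation

/-! With `m` periods left and capacity `r`, compare OSO with the benchmark `W m c = E[min(N, c)]`
(`truncMean`), where `c = ⌊r⌋` and `N` is the binomial number of valuable items to come. The
benchmark ignores items of value `φ`, so the regret bound is uniform in `φ`. An extra unit of
capacity raises `W m k` by `G = P(N ≥ k + 1)` (`tailProb`). Hence a period with capacity `k + 1`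
costs at most `1 - G` when a valuable item is rejected and at most `G` when a cheap one is accepted.

Equivariance makes all items of one kind equally likely to be accepted, and optimality says how many
of each kind are. So OSO rejects a valuable item with probability at most `E[1 - min(1, (k + 1)/(1 +
N))]` and accepts a cheap one with probability at most `E[(k + 1 - N)⁺/(m + 1 - N)]`. Multiplied by
the costs, these become expectations over two independent copies of `N`, one on each side of the
capacity. Such a product is controlled by the deviations of the copies from the mean `m p`, whose
expectation is at most `√(m p)`. The expected loss per period is thus at most `6 √(m p) / m`
(`reject_loss_le`, `accept_loss_le`), which telescopes to `20 √(m p)` (`truncMean_sub_le_oso`).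

For the example, `m p = √T` is also the capacity. Therefore `W` is at least `√T - 1 - T^(1/4)`, OSO
earns at least `√T - 22 T^(1/4)`, and the optimum lies between `W` and `√T`. The myopic policy
spends its capacity on the first items whatever their values, which gives its exact reward and the
ratio `φ`. -/

namespace OnlineAllocation

/-! ### Expectations of discrete laws as finite sums -/

section Expectation

open MeasureTheory

variable {α β : Type} [Fintype α] [Fintype β]

/-- The expectation of a real function under a discrete law on a finite type. -/
noncomputable def expect (p : PMF α) (g : α → ℝ) : ℝ := ∑ a, (p a).toReal * g a

theorem sum_toReal_eq_one (p : PMF α) : ∑ a, (p a).toReal = 1 := by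
  have h := p.tsum_coe
  rw [tsum_fintype] at h
  rw [← ENNReal.toReal_sum fun a _ => p.apply_ne_top a, h, ENNReal.toReal_one]

theorem expect_const (p : PMF α) (r : ℝ) : expect p (fun _ => r) = r := by
  simp [expect, ← Finset.sum_mul, sum_toReal_eq_one]

theorem expect_add (p : PMF α) (f g : α → ℝ) :
    expect p (fun a => f a + g a) = expect p f + expect p g := by
  simp [expect, mul_add, Finset.sum_add_distrib]

theorem expect_sub (p : PMF α) (f g : α → ℝ) :
    expect p (fun a => f a - g a) = expect p f - expect p g := by
  simp [expect, mul_sub, Finset.sum_sub_distrib]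

theorem expect_const_mul (p : PMF α) (r : ℝ) (f : α → ℝ) :
    expect p (fun a => r * f a) = r * expect p f := by
  simp only [expect, Finset.mul_sum]
  exact Finset.sum_congr rfl fun a _ => by ring

theorem expect_sum {ι : Type} (s : Finset ι) (p : PMF α) (f : ι → α → ℝ) :
    expect p (fun a => ∑ i ∈ s, f i a) = ∑ i ∈ s, expect p (f i) := by
  simp only [expect, Finset.mul_sum]
  exact Finset.sum_comm

theorem expect_mono_support (p : PMF α) {f g : α → ℝ} (h : ∀ a ∈ p.support, f a ≤ g a) :
    expect p f ≤ expect p g := by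
  refine Finset.sum_le_sum fun a _ => ?_
  by_cases ha : a ∈ p.support
  · exact mul_le_mul_of_nonneg_left (h a ha) ENNReal.toReal_nonneg
  · rw [PMF.mem_support_iff, not_not] at ha
    simp [ha]

theorem expect_mono (p : PMF α) {f g : α → ℝ} (h : ∀ a, f a ≤ g a) :
    expect p f ≤ expect p g := expect_mono_support p fun a _ => h a

theorem expect_nonneg (p : PMF α) {f : α → ℝ} (h : ∀ a, 0 ≤ f a) : 0 ≤ expect p f :=
  Finset.sum_nonneg fun a _ => mul_nonneg ENNReal.toReal_nonneg (h a)

theorem expect_congr_support (p : PMF α) {f g : α → ℝ} (h : ∀ a ∈ p.support, f a = g a) :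
    expect p f = expect p g :=
  le_antisymm (expect_mono_support p fun a ha => (h a ha).le)
    (expect_mono_support p fun a ha => (h a ha).ge)

theorem expect_pure (a : α) (g : α → ℝ) : expect (PMF.pure a) g = g a := by
  classical
  rw [expect, Finset.sum_eq_single a]
  · simp
  · intro b _ hb
    simp [PMF.pure_apply, hb]
  · simp

theorem expect_bind (p : PMF α) (f : α → PMF β) (g : β → ℝ) :
    expect (p.bind f) g = expect p fun a => expect (f a) g := by
  have h : ∀ b, ((p.bind f) b).toReal = ∑ a, (p a).toReal * (f a b).toReal := fun b => by
    rw [PMF.bind_apply, tsum_fintype, ENNReal.toReal_sum fun a _ =>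
      ENNReal.mul_ne_top (p.apply_ne_top a) ((f a).apply_ne_top b)]
    simp only [ENNReal.toReal_mul]
  simp only [expect, h, Finset.sum_mul, Finset.mul_sum]
  rw [Finset.sum_comm]
  exact Finset.sum_congr rfl fun a _ => Finset.sum_congr rfl fun b _ => by ring

theorem expect_map (p : PMF α) (f : α → β) (g : β → ℝ) :
    expect (p.map f) g = expect p (g ∘ f) := by
  rw [PMF.map, expect_bind]
  simp only [Function.comp_apply, expect_pure]
  rfl

/-- Two independent copies: a product of expectations is bounded through a pointwise bound. -/
theorem expect_mul_expect_le (p : PMF α) {f g h : α → ℝ} (H : ∀ a b, f a * g b ≤ h a + h b) :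
    expect p f * expect p g ≤ 2 * expect p h := by
  calc expect p f * expect p g = expect p fun a => expect p fun b => f a * g b := by
        simp only [expect_const_mul]
        rw [mul_comm, ← expect_const_mul]
        simp only [mul_comm]
    _ ≤ expect p fun a => expect p fun b => h a + h b :=
        expect_mono p fun a => expect_mono p fun b => H a b
    _ = 2 * expect p h := by
        simp only [expect_add, expect_const]
        ring

theorem toMeasure_bind_eq_sum (p : PMF α) (f : α → PMF ℝ) :
    (p.bind f).toMeasure = ∑ a, p a • (f a).toMeasure := by
  ext s hs
  rw [PMF.toMeasure_bind_apply _ _ _ hs, tsum_fintype, Measure.finsetSum_apply]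
  rfl

/-- Integrability has to be carried along with every construction of a reward law, since the Bochner
integral in `mean` is additive only for integrable functions. -/
theorem integrable_bind (p : PMF α) (f : α → PMF ℝ)
    (hf : ∀ a, Integrable (fun v : ℝ => v) (f a).toMeasure) :
    Integrable (fun v : ℝ => v) (p.bind f).toMeasure := by
  rw [toMeasure_bind_eq_sum]
  exact integrable_finsetSum_measure.2 fun a _ => (hf a).smul_measure (p.apply_ne_top a)

theorem mean_bind (p : PMF α) (f : α → PMF ℝ)
    (hf : ∀ a, Integrable (fun v : ℝ => v) (f a).toMeasure) :
    mean (p.bind f) = expect p fun a => mean (f a) := by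
  rw [mean, toMeasure_bind_eq_sum, integral_finsetSum_measure fun a _ =>
    (hf a).smul_measure (p.apply_ne_top a)]
  simp only [integral_smul_measure, smul_eq_mul]
  rfl

theorem integrable_pure (r : ℝ) : Integrable (fun v : ℝ => v) (PMF.pure r).toMeasure := by
  rw [PMF.toMeasure_pure]
  exact integrable_dirac (by simp)

theorem mean_pure (r : ℝ) : mean (PMF.pure r) = r := by
  rw [mean, PMF.toMeasure_pure, integral_dirac]

theorem integrable_map_add (q : PMF ℝ) (r : ℝ)
    (hq : Integrable (fun v : ℝ => v) q.toMeasure) :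
    Integrable (fun v : ℝ => v) (q.map fun v => r + v).toMeasure := by
  rw [← PMF.toMeasure_map q (f := fun v => r + v) (by fun_prop), integrable_map_measure (by fun_prop) (by fun_prop)]
  exact (integrable_const r).add hq

theorem mean_map_add (q : PMF ℝ) (r : ℝ) (hq : Integrable (fun v : ℝ => v) q.toMeasure) :
    mean (q.map fun v => r + v) = r + mean q := by
  rw [mean, ← PMF.toMeasure_map q (f := fun v => r + v) (by fun_prop), integral_map (by fun_prop) (by fun_prop),
    integral_add (integrable_const r) hq]
  simp [mean]

theorem mean_map (p : PMF α) (g : α → ℝ) : mean (p.map g) = expect p g := by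
  rw [PMF.map, mean_bind]
  · simp only [Function.comp_apply, mean_pure]
  · exact fun a => integrable_pure _

end Expectation

/-! ### Moments of the number of valuable items -/

section Binomial

/-- The number of successes. -/
def numTrue {n : ℕ} (t : Fin n → Bool) : ℕ := (Finset.univ.filter fun i => t i = true).card

theorem numTrue_le {n : ℕ} (t : Fin n → Bool) : numTrue t ≤ n :=
  (Finset.card_le_univ _).trans_eq (Fintype.card_fin n)

theorem numTrue_cons {n : ℕ} (c : Bool) (s : Fin n → Bool) :
    numTrue (Fin.cons c s : Fin (n + 1) → Bool) = (if c then 1 else 0) + numTrue s := by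
  simp only [numTrue, Finset.card_filter, Fin.sum_univ_succ, Fin.cons_zero, Fin.cons_succ]

variable (p : ℝ≥0) (hp : p ≤ 1)

theorem expect_coin (g : Bool → ℝ) :
    expect (coin p hp) g = p * g true + (1 - p) * g false := by
  have h : ((1 : ℝ≥0∞) - p).toReal = 1 - p := by
    rw [ENNReal.toReal_sub_of_le (by exact_mod_cast hp) (by simp)]
    simp
  simp [expect, coin, PMF.ofFintype_apply, h]

theorem expect_iid_zero (g : (Fin 0 → Bool) → ℝ) :
    expect (iid (coin p hp) 0) g = g Fin.elim0 := expect_pure _ _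

theorem expect_iid_succ (m : ℕ) (g : (Fin (m + 1) → Bool) → ℝ) :
    expect (iid (coin p hp) (m + 1)) g =
      p * expect (iid (coin p hp) m) (fun s => g (Fin.cons true s)) +
        (1 - p) * expect (iid (coin p hp) m) (fun s => g (Fin.cons false s)) := by
  rw [iid, expect_bind, expect_coin]
  simp only [expect_bind, expect_pure]

theorem expect_numTrue (m : ℕ) :
    expect (iid (coin p hp) m) (fun s => (numTrue s : ℝ)) = m * p := by
  induction m with
  | zero => simp [expect_iid_zero, numTrue]
  | succ m ih =>
    simp only [expect_iid_succ, numTrue_cons, Nat.cast_add, expect_add, expect_const, ih]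
    push_cast
    simp
    ring

theorem expect_numTrue_sq (m : ℕ) :
    expect (iid (coin p hp) m) (fun s => (numTrue s : ℝ) ^ 2) =
      m * p * (1 - p) + (m * p) ^ 2 := by
  induction m with
  | zero => simp [expect_iid_zero, numTrue]
  | succ m ih =>
    simp only [expect_iid_succ, numTrue_cons, Nat.cast_add, add_sq, expect_add, expect_const, ih,
      expect_const_mul, expect_numTrue]
    push_cast
    simp
    ring

/-- The variance is at most `m p`, and the mean absolute deviation is at most the standard
deviation. -/
theorem expect_abs_dev_le (m : ℕ) :
    expect (iid (coin p hp) m) (fun s => |(numTrue s : ℝ) - m * p|) ≤ √(m * p) := by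
  have hp1 : (p : ℝ) ≤ 1 := by exact_mod_cast hp
  have hmp : (0 : ℝ) ≤ m * p := by positivity
  have hvar : expect (iid (coin p hp) m) (fun s => ((numTrue s : ℝ) - m * p) ^ 2) ≤ m * p := by
    have : ∀ s : Fin m → Bool, ((numTrue s : ℝ) - m * p) ^ 2 =
        (numTrue s : ℝ) ^ 2 - 2 * (m * p) * numTrue s + (m * p) ^ 2 := fun s => by ring
    simp only [this, expect_add, expect_sub, expect_const_mul, expect_const, expect_numTrue,
      expect_numTrue_sq]
    nlinarith [mul_nonneg hmp p.coe_nonneg]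
  set v := √((m : ℝ) * p)
  have h0 : 0 ≤ v := Real.sqrt_nonneg _
  have hsq : v ^ 2 = m * p := Real.sq_sqrt hmp
  rcases h0.eq_or_lt with h0 | h0
  · have : (m : ℝ) * p = 0 := by
      rw [← hsq, ← h0]; simp
    have : (fun s : Fin m → Bool => |(numTrue s : ℝ) - m * p|) = fun s => (numTrue s : ℝ) := by
      funext s
      simp [this]
    rw [this, expect_numTrue]
    linarith
  · have hv := h0.ne'
    -- The inequality `y ≤ y² / (2v) + v / 2`, taken with `v = √(m p)`, replaces Cauchy–Schwarz. It
    -- needs `v ≠ 0`, hence the separate degenerate case.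
    have h : ∀ s : Fin m → Bool, |(numTrue s : ℝ) - m * p| ≤
        1 / (2 * v) * ((numTrue s : ℝ) - m * p) ^ 2 + v / 2 := fun s => by
      rw [← sq_abs]
      set y := |(numTrue s : ℝ) - m * p|
      have : 1 / (2 * v) * y ^ 2 + v / 2 - y = 1 / (2 * v) * (y - v) ^ 2 := by
        field_simp
        ring
      have : 0 ≤ 1 / (2 * v) * (y - v) ^ 2 := by positivity
      linarith
    refine (expect_mono _ h).trans ?_
    rw [expect_add, expect_const_mul, expect_const]
    have : 1 / (2 * v) * expect (iid (coin p hp) m) (fun s => ((numTrue s : ℝ) - m * p) ^ 2) ≤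
        1 / (2 * v) * v ^ 2 := by
      rw [hsq]
      gcongr
    have e : 1 / (2 * v) * v ^ 2 = v / 2 := by field_simp
    linarith

theorem iid_map {α β : Type} (D : PMF α) (f : α → β) (n : ℕ) :
    iid (D.map f) n = (iid D n).map fun s => f ∘ s := by
  induction n with
  | zero =>
    rw [iid, iid, PMF.pure_map]
    congr 1
    exact Subsingleton.elim _ _
  | succ n ih =>
    rw [iid, iid, PMF.map_bind, PMF.bind_map]
    congr 1
    funext a
    rw [Function.comp_apply, ih, PMF.map_bind, PMF.bind_map]
    congr 1
    funext s
    rw [Function.comp_apply, PMF.pure_map]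
    congr 1
    funext i
    refine Fin.cases ?_ (fun i => ?_) i <;> simp

end Binomial

/-! ### Optimal plans for items of size one -/

section UnitItems

variable {n : ℕ}

/-- The set of items that a plan accepts. -/
def accepted (x : Fin n → Option Unit) : Finset (Fin n) :=
  Finset.univ.filter fun i => x i = some ()

theorem mem_accepted {x : Fin n → Option Unit} {i : Fin n} :
    i ∈ accepted x ↔ x i = some () := by simp [accepted]

/-- The plan that accepts a given set of items. -/
def acceptPlan (S : Finset (Fin n)) : Fin n → Option Unit :=
  fun i => if i ∈ S then some () else none

theorem accepted_acceptPlan (S : Finset (Fin n)) : accepted (acceptPlan S) = S := by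
  ext i
  simp [mem_accepted, acceptPlan]

theorem unitItem_gain (r : ℝ) (x : Option Unit) :
    (unitItem r).gain x = if x = some () then r else 0 := by
  cases x <;> simp [Item.gain, unitItem]

theorem unitItem_consumption (r : ℝ) (x : Option Unit) (k : Unit) :
    (unitItem r).consumption x k = if x = some () then 1 else 0 := by
  cases x <;> simp [Item.consumption, unitItem]

theorem feasible_unitItem_iff (r : Fin n → ℝ) (b : Unit → ℝ) (x : Fin n → Option Unit) :
    Feasible (fun i => unitItem (r i)) b x ↔ ((accepted x).card : ℝ) ≤ b () := by
  simp only [Feasible, unitItem_consumption, accepted, Finset.sum_boole]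
  exact ⟨fun h => h (), fun h _ => h⟩

theorem planReward_unitItem (r : Fin n → ℝ) (x : Fin n → Option Unit) :
    planReward (fun i => unitItem (r i)) x = ∑ i ∈ accepted x, r i := by
  simp only [planReward, unitItem_gain, accepted, Finset.sum_filter]

theorem exists_feasible_unitItem (r : Fin n → ℝ) {b : Unit → ℝ} (hb : 0 ≤ b ()) :
    ∃ x, Feasible (fun i => unitItem (r i)) b x :=
  ⟨acceptPlan ∅, by rw [feasible_unitItem_iff, accepted_acceptPlan]; simpa using hb⟩

theorem IsOptimal.sum_le {r : Fin n → ℝ} {b : Unit → ℝ} {x : Fin n → Option Unit}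
    (hx : IsOptimal (fun i => unitItem (r i)) b x) {S : Finset (Fin n)}
    (hS : (S.card : ℝ) ≤ b ()) : ∑ i ∈ S, r i ≤ ∑ i ∈ accepted x, r i := by
  have h := hx.2 (acceptPlan S) (by rwa [feasible_unitItem_iff, accepted_acceptPlan])
  rwa [planReward_unitItem, planReward_unitItem, accepted_acceptPlan] at h

/-- The item of value `1` or `φ`. -/
noncomputable def coinItem (φ : ℝ) (c : Bool) : Item Unit Unit := unitItem (cond c 1 φ)

variable {φ : ℝ} {t : Fin n → Bool} {b : Unit → ℝ} {x : Fin n → Option Unit}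

/-- The number of accepted items of a given kind. -/
def numAccepted (t : Fin n → Bool) (x : Fin n → Option Unit) (c : Bool) : ℕ :=
  ((accepted x).filter fun i => t i = c).card

theorem numAccepted_add (t : Fin n → Bool) (x : Fin n → Option Unit) :
    numAccepted t x true + numAccepted t x false = (accepted x).card := by
  rw [numAccepted, numAccepted,
    ← Finset.card_filter_add_card_filter_not (s := accepted x) fun i => t i = true]
  simp only [Bool.not_eq_true]

theorem card_accepted_le (hb : 0 ≤ b ()) (hx : IsOptimal (fun i => coinItem φ (t i)) b x) :
    (accepted x).card ≤ ⌊b ()⌋₊ :=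
  (Nat.le_floor_iff hb).2 ((feasible_unitItem_iff _ _ _).1 hx.1)

/-- An optimal plan accepts as many valuable items as possible. -/
theorem le_numAccepted_true (hφ : φ < 1) (hb : 0 ≤ b ())
    (hx : IsOptimal (fun i => coinItem φ (t i)) b x) :
    min (numTrue t) ⌊b ()⌋₊ ≤ numAccepted t x true := by
  by_contra! h
  obtain ⟨h1, h2⟩ := lt_min_iff.1 h
  obtain ⟨i, hi, hix⟩ := Finset.exists_mem_notMem_of_card_lt_card h1
  have hti : t i = true := by simpa using hi
  have hi' : i ∉ accepted x := fun hh => hix (by simp [hh, hti])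
  -- Exchange argument: a rejected valuable item `i` can be added if there is room. Otherwise the
  -- capacity is full, some cheap item is accepted, and `i` can replace it.
  by_cases hc : (accepted x).card + 1 ≤ ⌊b ()⌋₊
  · have h3 := IsOptimal.sum_le hx (S := insert i (accepted x)) (by
      rw [Finset.card_insert_of_notMem hi']
      exact (Nat.le_floor_iff hb).1 hc)
    rw [Finset.sum_insert hi', hti] at h3
    simp only [cond_true] at h3
    linarith
  · have h3 : 0 < numAccepted t x false := by
      have := numAccepted_add t x
      omega
    obtain ⟨j, hj⟩ := Finset.card_pos.1 h3
    rw [Finset.mem_filter] at hj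
    have hi'' : i ∉ (accepted x).erase j := fun hh => hi' (Finset.mem_of_mem_erase hh)
    have h4 := IsOptimal.sum_le hx (S := insert i ((accepted x).erase j)) (by
      rw [Finset.card_insert_of_notMem hi'', Finset.card_erase_add_one hj.1]
      exact (Nat.le_floor_iff hb).1 (card_accepted_le hb hx))
    rw [Finset.sum_insert hi'', hti, ← Finset.add_sum_erase _ _ hj.1, hj.2] at h4
    simp only [cond_true, cond_false] at h4
    linarith

theorem numAccepted_false_le (hφ : φ < 1) (hb : 0 ≤ b ())
    (hx : IsOptimal (fun i => coinItem φ (t i)) b x) :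
    numAccepted t x false ≤ ⌊b ()⌋₊ - numTrue t := by
  have h1 := le_numAccepted_true hφ hb hx
  have h2 := numAccepted_add t x
  have h3 := card_accepted_le hb hx
  have h4 : numAccepted t x true ≤ numTrue t :=
    Finset.card_le_card fun i hi => by
      rw [Finset.mem_filter] at hi
      simp [hi.2]
  omega

end UnitItems

/-! ### Acceptance probabilities under an equivariant solver -/

section AcceptProb

/-- The probability that a random plan accepts the item `i`. -/
noncomputable def acceptProb {n : ℕ} (q : PMF (Fin n → Option Unit)) (i : Fin n) : ℝ :=
  expect q fun x => if x i = some () then 1 else 0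

theorem sum_acceptProb {n : ℕ} (q : PMF (Fin n → Option Unit)) (t : Fin n → Bool) (c : Bool) :
    ∑ i ∈ Finset.univ.filter (fun i => t i = c), acceptProb q i =
      expect q fun x => (numAccepted t x c : ℝ) := by
  simp only [acceptProb]
  rw [← expect_sum]
  congr 1
  funext x
  rw [Finset.sum_boole, numAccepted, accepted, Finset.filter_filter, Finset.filter_filter]
  simp only [and_comm]

variable {σ : Solver Unit Unit} {n : ℕ} {φ : ℝ} {t : Fin n → Bool} {b : Unit → ℝ}

/-- Swapping two items of the same kind leaves the program unchanged, so by equivariance the law of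
the plan is invariant under the swap. -/
theorem acceptProb_eq (hσ : σ.Equivariant) {i j : Fin n} (h : t i = t j) :
    acceptProb (σ.solve n (fun i => coinItem φ (t i)) b) i =
      acceptProb (σ.solve n (fun i => coinItem φ (t i)) b) j := by
  have h1 := hσ n (fun i => coinItem φ (t i)) b (Equiv.swap i j)
  have h2 : (fun i => coinItem φ (t i)) ∘ (Equiv.swap i j) = fun i => coinItem φ (t i) := by
    funext k
    simp only [Function.comp_apply]
    congr 1
    rcases eq_or_ne k i with rfl | hi
    · rw [Equiv.swap_apply_left, h]
    rcases eq_or_ne k j with rfl | hj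
    · rw [Equiv.swap_apply_right, h]
    rw [Equiv.swap_apply_of_ne_of_ne hi hj]
  rw [h2] at h1
  conv_lhs => rw [h1]
  rw [acceptProb, expect_map, acceptProb]
  congr 1
  funext x
  simp

/-- By symmetry within a kind, the expected number of accepted items of that kind is shared equally.
This turns the counts forced by optimality into bounds for a single item. -/
theorem card_mul_acceptProb (hσ : σ.Equivariant) (i : Fin n) :
    ((Finset.univ.filter fun j => t j = t i).card : ℝ) *
        acceptProb (σ.solve n (fun i => coinItem φ (t i)) b) i =
      expect (σ.solve n (fun i => coinItem φ (t i)) b) fun x => (numAccepted t x (t i) : ℝ) := by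
  rw [← sum_acceptProb, Finset.sum_congr rfl fun j hj =>
    acceptProb_eq hσ (Finset.mem_filter.1 hj).2, Finset.sum_const, nsmul_eq_mul]

theorem isOptimal_of_mem_support (σ : Solver Unit Unit) (r : Fin n → ℝ) (hb : 0 ≤ b ())
    {x : Fin n → Option Unit} (hx : x ∈ (σ.solve n (fun i => unitItem (r i)) b).support) :
    IsOptimal (fun i => unitItem (r i)) b x :=
  σ.optimal _ _ _ (exists_feasible_unitItem r hb) _ hx

theorem le_acceptProb_true (hσ : σ.Equivariant) (hφ : φ < 1) (hb : 0 ≤ b ()) {i : Fin n}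
    (hi : t i = true) :
    min 1 ((⌊b ()⌋₊ : ℝ) / numTrue t) ≤
      acceptProb (σ.solve n (fun i => coinItem φ (t i)) b) i := by
  have h := card_mul_acceptProb (φ := φ) (b := b) hσ (t := t) i
  rw [hi] at h
  change (numTrue t : ℝ) * _ = _ at h
  have hpos : (0 : ℝ) < numTrue t :=
    Nat.cast_pos.2 (Finset.card_pos.2 ⟨i, by simp [hi]⟩)
  have h2 : ((min (numTrue t) ⌊b ()⌋₊ : ℕ) : ℝ) ≤
      expect (σ.solve n (fun i => coinItem φ (t i)) b) fun x => (numAccepted t x true : ℝ) := by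
    rw [← expect_const (σ.solve n (fun i => coinItem φ (t i)) b)
      ((min (numTrue t) ⌊b ()⌋₊ : ℕ) : ℝ)]
    exact expect_mono_support _ fun x hx => Nat.cast_le.2
      (le_numAccepted_true hφ hb (isOptimal_of_mem_support σ _ hb hx))
  rw [← h] at h2
  rw [← div_le_iff₀' hpos] at h2
  refine le_trans (le_of_eq ?_) h2
  rw [Nat.cast_min, ← min_div_div_right hpos.le, div_self hpos.ne']

theorem acceptProb_false_le (hσ : σ.Equivariant) (hφ : φ < 1) (hb : 0 ≤ b ()) {i : Fin n}
    (hi : t i = false) :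
    acceptProb (σ.solve n (fun i => coinItem φ (t i)) b) i ≤
      ((⌊b ()⌋₊ - numTrue t : ℕ) : ℝ) / ((n : ℝ) - numTrue t) := by
  have h := card_mul_acceptProb (φ := φ) (b := b) hσ (t := t) i
  rw [hi] at h
  have hcard : (n : ℝ) - numTrue t = (Finset.univ.filter fun j => t j = false).card := by
    have := Finset.card_filter_add_card_filter_not (s := Finset.univ) (fun i => t i = true)
    rw [sub_eq_iff_eq_add, numTrue]
    simp only [Bool.not_eq_true, Finset.card_univ, Fintype.card_fin] at this
    rw [add_comm]
    exact_mod_cast this.symm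
  rw [hcard]
  have hpos : (0 : ℝ) < (Finset.univ.filter fun j => t j = false).card :=
    Nat.cast_pos.2 (Finset.card_pos.2 ⟨i, by simp [hi]⟩)
  rw [le_div_iff₀' hpos, h, ← expect_const (σ.solve n (fun i => coinItem φ (t i)) b)
    ((⌊b ()⌋₊ - numTrue t : ℕ) : ℝ)]
  exact expect_mono_support _ fun x hx => Nat.cast_le.2
      (numAccepted_false_le hφ hb (isOptimal_of_mem_support σ _ hb hx))

theorem acceptProb_eq_zero (σ : Solver Unit Unit) (r : Fin n → ℝ) (hb : 0 ≤ b ()) (hb1 : b () < 1)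
    (i : Fin n) : acceptProb (σ.solve n (fun i => unitItem (r i)) b) i = 0 := by
  rw [← expect_const (σ.solve n (fun i => unitItem (r i)) b) 0]
  refine expect_congr_support _ fun x hx => if_neg fun hi => ?_
  have h := (feasible_unitItem_iff _ _ _).1 (isOptimal_of_mem_support σ r hb hx).1
  have : 0 < (accepted x).card := Finset.card_pos.2 ⟨i, mem_accepted.2 hi⟩
  have : (1 : ℝ) ≤ (accepted x).card := by exact_mod_cast this
  linarith

end AcceptProb

/-! ### One-period recursion for the value of a policy -/

section Value

open MeasureTheory

variable (p : ℝ≥0) (hp : p ≤ 1) (φ : ℝ) (P : Policy Unit Unit)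

theorem integrable_rewardLaw (m : ℕ) (b : Unit → ℝ) :
    Integrable (fun v : ℝ => v)
      (rewardLaw ((coin p hp).map (coinItem φ)) P m b).toMeasure := by
  induction m generalizing b with
  | zero => exact integrable_pure 0
  | succ m ih =>
    rw [rewardLaw, PMF.bind_map]
    exact integrable_bind _ _ fun c => integrable_bind _ _ fun x => integrable_map_add _ _ (ih _)

/-- The expected total reward that a policy collects during `m` periods with capacity `r`. -/
noncomputable def policyValue (m : ℕ) (r : ℝ) : ℝ :=
  mean (rewardLaw ((coin p hp).map (coinItem φ)) P m fun _ => r)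

/-- The probability that a random decision is to accept. -/
noncomputable def decisionProb (q : PMF (Option Unit)) : ℝ :=
  expect q fun x => if x = some () then 1 else 0

theorem decisionProb_nonneg (q : PMF (Option Unit)) : 0 ≤ decisionProb q :=
  expect_nonneg _ fun x => by split_ifs <;> norm_num

theorem decisionProb_le_one (q : PMF (Option Unit)) : decisionProb q ≤ 1 := by
  rw [← expect_const q 1]
  exact expect_mono _ fun x => by split_ifs <;> norm_num

theorem expect_option (q : PMF (Option Unit)) (g : Option Unit → ℝ) :
    expect q g = decisionProb q * g (some ()) + (1 - decisionProb q) * g none := by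
  have h := sum_toReal_eq_one q
  simp only [Fintype.sum_option, Finset.univ_unique, Finset.sum_singleton,
    PUnit.default_eq_unit] at h
  simp only [decisionProb, expect, Fintype.sum_option, Finset.univ_unique, Finset.sum_singleton,
    PUnit.default_eq_unit]
  have h' : (q none).toReal = 1 - (q (some PUnit.unit)).toReal := by linarith
  simp [h']
  ring

theorem policyValue_zero (r : ℝ) : policyValue p hp φ P 0 r = 0 := mean_pure 0

theorem policyValue_succ (m : ℕ) (r : ℝ) :
    policyValue p hp φ P (m + 1) r =
      p * (decisionProb (P m (fun _ => r) (coinItem φ true)) *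
            (1 + policyValue p hp φ P m (r - 1)) +
          (1 - decisionProb (P m (fun _ => r) (coinItem φ true))) * policyValue p hp φ P m r) +
      (1 - p) * (decisionProb (P m (fun _ => r) (coinItem φ false)) *
            (φ + policyValue p hp φ P m (r - 1)) +
          (1 - decisionProb (P m (fun _ => r) (coinItem φ false))) *
            policyValue p hp φ P m r) := by
  have hint := integrable_rewardLaw p hp φ P m
  have hint' : ∀ (ξ : Item Unit Unit), Integrable (fun v : ℝ => v)
      ((P m (fun _ => r) ξ).bind fun x => (rewardLaw ((coin p hp).map (coinItem φ)) P m
        (fun k => r - ξ.consumption x k)).map fun v => ξ.gain x + v).toMeasure :=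
    fun ξ => integrable_bind _ _ fun x => integrable_map_add _ _ (hint _)
  rw [policyValue, rewardLaw, PMF.bind_map]
  refine (mean_bind _ _ fun c => hint' (coinItem φ c)).trans ?_
  rw [expect_coin]
  rw [mean_bind _ _ fun x => integrable_map_add _ _ (hint _),
    mean_bind _ _ fun x => integrable_map_add _ _ (hint _), expect_option, expect_option]
  simp only [mean_map_add _ _ (hint _), coinItem, unitItem_gain, unitItem_consumption, policyValue]
  simp

theorem policyValue_nonneg (hφ : 0 ≤ φ) (m : ℕ) (r : ℝ) : 0 ≤ policyValue p hp φ P m r := by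
  have hp1 : (0 : ℝ) ≤ 1 - p := sub_nonneg.2 (by exact_mod_cast hp)
  induction m generalizing r with
  | zero => rw [policyValue_zero]
  | succ m ih =>
    rw [policyValue_succ]
    have h1 := fun q => sub_nonneg.2 (decisionProb_le_one q)
    have h0 := decisionProb_nonneg
    refine add_nonneg (mul_nonneg p.2 ?_) (mul_nonneg hp1 ?_)
    · exact add_nonneg (mul_nonneg (h0 _) (add_nonneg zero_le_one (ih _))) (mul_nonneg (h1 _) (ih _))
    · exact add_nonneg (mul_nonneg (h0 _) (add_nonneg hφ (ih _))) (mul_nonneg (h1 _) (ih _))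

end Value

/-! ### Exact value of the myopic policy -/

section Myopic

variable (p : ℝ≥0) (hp : p ≤ 1) {φ : ℝ} (σ : Solver Unit Unit)

theorem decisionProb_map {n : ℕ} (q : PMF (Fin n → Option Unit)) (i : Fin n) :
    decisionProb (q.map fun x => x i) = acceptProb q i := by
  rw [decisionProb, expect_map]
  rfl

theorem decisionProb_myopic (m : ℕ) {r : ℝ} (hr : 1 ≤ r) {v : ℝ} (hv : 0 < v) :
    decisionProb (myopic σ m (fun _ => r) (unitItem v)) = 1 := by
  rw [myopic, decisionProb_map, acceptProb,
    ← expect_const (σ.solve 1 (fun _ => unitItem v) fun _ => r) 1]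
  refine expect_congr_support _ fun x hx => ?_
  rw [expect_const]
  refine if_pos ?_
  have hopt := isOptimal_of_mem_support σ (fun _ => v) (zero_le_one.trans hr) hx
  have h := hopt.sum_le (S := Finset.univ) (by simpa using hr)
  by_contra h0
  have h1 : accepted x = ∅ := by
    ext i
    rw [Subsingleton.elim i 0, mem_accepted]
    simp [h0]
  rw [h1] at h
  simp at h
  linarith

/-- Every item has positive value, so the policy accepts each arrival until less than one unit is
left. The accepted items are the first ones, independently of their values. -/
theorem policyValue_myopic (hφ : 0 < φ) (m : ℕ) {r : ℝ} (hr : 0 ≤ r) :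
    policyValue p hp φ (myopic σ) m r =
      ((min m ⌊r⌋₊ : ℕ) : ℝ) * (p + φ * (1 - p)) := by
  induction m generalizing r with
  | zero => simp [policyValue_zero]
  | succ m ih =>
    rw [policyValue_succ]
    rcases lt_or_ge r 1 with h1 | h1
    · have h0 : ∀ c, decisionProb (myopic σ m (fun _ => r) (coinItem φ c)) = 0 := fun c => by
        rw [myopic, decisionProb_map]
        exact acceptProb_eq_zero σ _ hr h1 0
      rw [h0, h0, ih hr, Nat.floor_eq_zero.2 h1]
      simp
    · rw [coinItem, coinItem, decisionProb_myopic σ m h1 (by simp),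
        decisionProb_myopic σ m h1 (by simpa using hφ), ih (sub_nonneg.2 h1), Nat.floor_sub_one]
      obtain ⟨k, hk⟩ : ∃ k, ⌊r⌋₊ = k + 1 :=
        Nat.exists_eq_succ_of_ne_zero (Nat.floor_pos.2 h1).ne'
      rw [hk, Nat.add_sub_cancel, Nat.add_min_add_right]
      push_cast
      ring

end Myopic

/-! ### Regret of single-sample OSO -/

section Online

variable (p : ℝ≥0) (hp : p ≤ 1) {φ : ℝ} {σ : Solver Unit Unit}

/-- The current item sits at index `0` of the sampled program, so bounds on `acceptProb` average
over the sample to bounds on the decision. -/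
theorem decisionProb_oso (m : ℕ) (b : Unit → ℝ) (c : Bool) :
    decisionProb (oso σ ((coin p hp).map (coinItem φ)) m b (coinItem φ c)) =
      expect (iid (coin p hp) m) fun s => acceptProb (σ.solve (m + 1)
        (fun i => coinItem φ ((Fin.cons c s : Fin (m + 1) → Bool) i)) b) 0 := by
  rw [oso, iid_map, PMF.bind_map, decisionProb, expect_bind]
  congr 1
  funext s
  rw [Function.comp_apply]
  have : (Fin.cons (coinItem φ c) (coinItem φ ∘ s) : Fin (m + 1) → Item Unit Unit) =
      fun i => coinItem φ ((Fin.cons c s : Fin (m + 1) → Bool) i) := by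
    funext i
    refine Fin.cases ?_ (fun i => ?_) i <;> simp
  rw [this]
  exact decisionProb_map _ _

theorem le_decisionProb_oso (hσ : σ.Equivariant) (hφ : φ < 1) (m : ℕ) {r : ℝ} (hr : 0 ≤ r) :
    expect (iid (coin p hp) m) (fun s => min 1 ((⌊r⌋₊ : ℝ) / (1 + numTrue s))) ≤
      decisionProb (oso σ ((coin p hp).map (coinItem φ)) m (fun _ => r) (coinItem φ true)) := by
  rw [decisionProb_oso]
  refine expect_mono _ fun s => ?_
  have h := le_acceptProb_true (b := fun _ => r) (t := (Fin.cons true s : Fin (m + 1) → Bool))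
    hσ hφ hr (i := 0) rfl
  rw [numTrue_cons] at h
  simpa using h

theorem decisionProb_oso_le (hσ : σ.Equivariant) (hφ : φ < 1) (m : ℕ) {r : ℝ} (hr : 0 ≤ r) :
    decisionProb (oso σ ((coin p hp).map (coinItem φ)) m (fun _ => r) (coinItem φ false)) ≤
      expect (iid (coin p hp) m) fun s =>
        ((⌊r⌋₊ - numTrue s : ℕ) : ℝ) / (m + 1 - numTrue s) := by
  rw [decisionProb_oso]
  refine expect_mono _ fun s => ?_
  have h := acceptProb_false_le (b := fun _ => r) (t := (Fin.cons false s : Fin (m + 1) → Bool))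
    hσ hφ hr (i := 0) rfl
  rw [numTrue_cons] at h
  simpa using h

/-- The expected number of successes, truncated at the capacity. -/
noncomputable def truncMean (m c : ℕ) : ℝ :=
  expect (iid (coin p hp) m) fun s => ((min (numTrue s) c : ℕ) : ℝ)

/-- The probability of at least `c` successes. -/
noncomputable def tailProb (m c : ℕ) : ℝ :=
  expect (iid (coin p hp) m) fun s => if c ≤ numTrue s then 1 else 0

theorem truncMean_zero_right (m : ℕ) : truncMean p hp m 0 = 0 := by
  simp [truncMean, expect_const]

/-- The tail probability is the marginal benchmark value of the last unit of capacity. -/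
theorem truncMean_add_tailProb (m k : ℕ) :
    truncMean p hp m (k + 1) = truncMean p hp m k + tailProb p hp m (k + 1) := by
  rw [truncMean, truncMean, tailProb, ← expect_add]
  congr 1
  funext s
  split_ifs with h
  · rw [min_eq_right h, min_eq_right (by omega)]
    push_cast
    ring
  · rw [min_eq_left (by omega), min_eq_left (by omega), add_zero]

/-- The benchmark obeys the recursion of the policy that accepts exactly the valuable items, which
makes a period-by-period comparison with OSO possible. -/
theorem truncMean_succ (m k : ℕ) :
    truncMean p hp (m + 1) (k + 1) =
      p * (1 + truncMean p hp m k) + (1 - p) * truncMean p hp m (k + 1) := by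
  have h : ∀ n : ℕ, ((min (1 + n) (k + 1) : ℕ) : ℝ) = 1 + ((min n k : ℕ) : ℝ) := fun n => by
    rw [add_comm 1 n, Nat.add_min_add_right]
    push_cast
    ring
  rw [truncMean, expect_iid_succ]
  simp only [numTrue_cons, if_true, h, expect_add, expect_const]
  simp [truncMean]

theorem tailProb_nonneg (m c : ℕ) : 0 ≤ tailProb p hp m c :=
  expect_nonneg _ fun s => by split_ifs <;> norm_num

theorem tailProb_le_one (m c : ℕ) : tailProb p hp m c ≤ 1 := by
  rw [← expect_const (iid (coin p hp) m) 1]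
  exact expect_mono _ fun s => by split_ifs <;> norm_num

theorem tailProb_eq_zero {m c : ℕ} (h : m < c) : tailProb p hp m c = 0 := by
  rw [← expect_const (iid (coin p hp) m) 0]
  exact congrArg _ (funext fun s => if_neg (by have := numTrue_le s; omega))

/-- Markov's inequality. -/
theorem mul_tailProb_le (m c : ℕ) : c * tailProb p hp m c ≤ m * p := by
  rw [← expect_numTrue p hp, tailProb, ← expect_const_mul]
  refine expect_mono _ fun s => ?_
  split_ifs with h
  · rw [mul_one]
    exact_mod_cast h
  · simp

theorem one_sub_tailProb (m k : ℕ) :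
    1 - tailProb p hp m (k + 1) =
      expect (iid (coin p hp) m) fun s => if numTrue s ≤ k then 1 else 0 := by
  rw [sub_eq_iff_eq_add, tailProb, ← expect_add]
  refine (expect_const (iid (coin p hp) m) 1).symm.trans (congrArg _ (funext fun s => ?_))
  split_ifs <;> first | omega | norm_num

/-- The loss from rejecting a valuable item while capacity would have remained. -/
theorem reject_loss_le {m k : ℕ} (hm : 0 < m) (hp0 : 0 < p) {α : ℝ}
    (hα : expect (iid (coin p hp) m)
      (fun s => min 1 (((k + 1 : ℕ) : ℝ) / (1 + numTrue s))) ≤ α) :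
    p * ((1 - α) * (1 - tailProb p hp m (k + 1))) ≤ 2 * (√(m * p) / m) := by
  have hμ : (0 : ℝ) < m * p := mul_pos (by exact_mod_cast hm) (by exact_mod_cast hp0)
  have hm' : (0 : ℝ) < m := by exact_mod_cast hm
  have hp0' : (0 : ℝ) < p := by exact_mod_cast hp0
  have h1 : (1 - α) * (1 - tailProb p hp m (k + 1)) ≤
      expect (iid (coin p hp) m) (fun s => 1 - min 1 (((k + 1 : ℕ) : ℝ) / (1 + numTrue s))) *
        (1 - tailProb p hp m (k + 1)) := by
    refine mul_le_mul_of_nonneg_right ?_ (sub_nonneg.2 (tailProb_le_one p hp _ _))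
    rw [expect_sub, expect_const]
    linarith
  rw [one_sub_tailProb] at h1 ⊢
  -- Here `s` is the path sampled by OSO and `t` an independent copy giving the true future. A loss
  -- needs `numTrue t ≤ k < numTrue s`, so the two counts differ and one of them is off the mean.
  have h2 := h1.trans (expect_mul_expect_le (iid (coin p hp) m)
    (h := fun s => 1 / (m * p) * |(numTrue s : ℝ) - m * p|) fun s t => ?_)
  · rw [expect_const_mul] at h2
    have h3 := expect_abs_dev_le p hp m
    calc _ ≤ p * (2 * (1 / (m * p) * √(m * p))) := by
          refine mul_le_mul_of_nonneg_left (h2.trans ?_) p.2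
          gcongr
      _ = _ := by field_simp
  · rw [← mul_add]
    generalize (m : ℝ) * p = μ at hμ
    have ha : (0 : ℝ) ≤ numTrue s := Nat.cast_nonneg _
    have hb : (0 : ℝ) ≤ numTrue t := Nat.cast_nonneg _
    have hR : 0 ≤ 1 / μ * (|(numTrue s : ℝ) - μ| + |(numTrue t : ℝ) - μ|) := by positivity
    split_ifs with htk
    · have htk' : (numTrue t : ℝ) ≤ k := by exact_mod_cast htk
      rw [mul_one, sub_le_comm]
      refine le_min (by linarith) ?_
      rw [le_div_iff₀ (by linarith)]
      push_cast
      generalize (numTrue s : ℝ) = a at *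
      generalize (numTrue t : ℝ) = b at *
      have key : (a - b) * μ ≤ (|a - μ| + |b - μ|) * (1 + a) := by
        have e1 := le_abs_self (a - μ)
        have e2 := neg_abs_le (b - μ)
        have e3 := neg_abs_le (a - μ)
        have e4 := abs_nonneg (a - μ)
        have e5 := abs_nonneg (b - μ)
        rcases le_total a b with hab | hab
        · exact (mul_nonpos_of_nonpos_of_nonneg (by linarith) hμ.le).trans (by positivity)
        -- If `μ ≤ a`, compare factor by factor. If `b ≤ a ≤ μ`, then `(μ - b) * (1 + a) ≥ (a - b) *
        -- μ` because `(μ - b) * a - (a - b) * μ = b * (μ - a)`.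
        rcases le_total μ a with h | h
        · exact mul_le_mul (by linarith) (by linarith) hμ.le (by linarith)
        · have : (μ - b) * (1 + a) ≤ (|a - μ| + |b - μ|) * (1 + a) :=
            mul_le_mul_of_nonneg_right (by linarith) (by linarith)
          nlinarith [mul_nonneg hb (sub_nonneg.2 h)]
      have : (a - b) ≤ 1 / μ * (|a - μ| + |b - μ|) * (1 + a) := by
        rw [one_div_mul_eq_div, div_mul_eq_mul_div, le_div_iff₀ hμ]
        exact key
      linarith
    · simpa using hR

/-- The loss from accepting an item of low value while the capacity will be needed. -/
theorem accept_loss_le {m k : ℕ} (hm : 0 < m) (hk : ((k + 1 : ℕ) : ℝ) * p ≤ 1) {β : ℝ}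
    (hβ1 : β ≤ 1) (hβ : β ≤ expect (iid (coin p hp) m)
      fun s => ((k + 1 - numTrue s : ℕ) : ℝ) / (m + 1 - numTrue s)) :
    β * tailProb p hp m (k + 1) ≤ 4 * (√(m * p) / m) := by
  have hm' : (0 : ℝ) < m := by exact_mod_cast hm
  have hμ : (0 : ℝ) ≤ m * p := by positivity
  have hG := tailProb_nonneg p hp m (k + 1)
  rcases lt_or_ge m (k + 1) with h1 | h1
  · rw [tailProb_eq_zero p hp h1, mul_zero]
    positivity
  -- For `k + 1 ≤ m < 2 (k + 1)` the denominator `m + 1 - N` may be small, so `β` is bounded by `1`.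
  -- Then `m p ≤ 2`, and Markov's inequality gives `m G ≤ 2 m p ≤ 4 √(m p)`. For larger `m` the
  -- denominator is at least `m / 2` whenever the numerator is nonzero.
  rcases lt_or_ge m (2 * (k + 1)) with h2 | h2
  · have h2' : (m : ℝ) ≤ 2 * (k + 1 : ℕ) := by exact_mod_cast h2.le
    have h3 := mul_tailProb_le p hp m (k + 1)
    have hmp2 : (m : ℝ) * p ≤ 2 := by
      have := mul_le_mul_of_nonneg_right h2' p.2
      change (m : ℝ) * p ≤ _ * (p : ℝ) at this
      linarith
    have hsq : √((m : ℝ) * p) ^ 2 = m * p := Real.sq_sqrt hμ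
    have hs2 : √((m : ℝ) * p) ≤ 2 := by
      rw [Real.sqrt_le_left (by norm_num)]
      linarith
    have hs0 := Real.sqrt_nonneg ((m : ℝ) * p)
    have h4 : β * tailProb p hp m (k + 1) ≤ tailProb p hp m (k + 1) :=
      mul_le_of_le_one_left hG hβ1
    refine h4.trans ?_
    rw [← mul_div_assoc, le_div_iff₀ hm']
    nlinarith [mul_le_mul_of_nonneg_right h2' hG]
  · have h2' : 2 * (k + 1 : ℝ) ≤ m := by exact_mod_cast h2
    refine (mul_le_mul_of_nonneg_right hβ hG).trans ?_
    refine (expect_mul_expect_le (iid (coin p hp) m)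
      (h := fun s => 2 / m * |(numTrue s : ℝ) - m * p|) fun s t => ?_).trans ?_
    · rw [← mul_add]
      generalize (m : ℝ) * p = μ
      have hR : 0 ≤ 2 / m * (|(numTrue s : ℝ) - μ| + |(numTrue t : ℝ) - μ|) := by positivity
      split_ifs with ht
      · rcases le_total (k + 1) (numTrue s) with hs | hs
        · rw [Nat.sub_eq_zero_of_le hs]
          simpa using hR
        · have hs' : (numTrue s : ℝ) ≤ k + 1 := by exact_mod_cast hs
          have ht' : (k + 1 : ℝ) ≤ numTrue t := by exact_mod_cast ht
          rw [mul_one, Nat.cast_sub hs, div_le_iff₀ (by linarith)]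
          push_cast
          have e1 := neg_abs_le ((numTrue s : ℝ) - μ)
          have e2 := le_abs_self ((numTrue t : ℝ) - μ)
          have e3 : (1 : ℝ) ≤ 2 / m * (m + 1 - numTrue s) := by
            rw [div_mul_eq_mul_div, le_div_iff₀ hm']
            linarith
          have e4 : 0 ≤ |(numTrue s : ℝ) - μ| + |(numTrue t : ℝ) - μ| := by positivity
          nlinarith [mul_le_mul_of_nonneg_left e3 e4]
      · simpa using hR
    · rw [expect_const_mul]
      have := expect_abs_dev_le p hp m
      calc _ ≤ 2 * (2 / m * √(m * p)) := by gcongr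
        _ = _ := by ring

/-- The constant `20` comes from here: `√(m + 1) - √m ≥ (3/10) / √m` for `m ≥ 1`, and `20 · 3/10 = 6
= 2 + 4` is the sum of the two loss constants. -/
theorem sqrt_step {m : ℕ} (hm : 0 < m) :
    6 * (√(m * p) / m) + 20 * √(m * p) ≤ 20 * √((m + 1 : ℕ) * p) := by
  rw [Real.sqrt_mul (by positivity), Real.sqrt_mul (by positivity)]
  have hm' : (1 : ℝ) ≤ m := by exact_mod_cast hm
  have h1 : √(m : ℝ) ^ 2 = m := Real.sq_sqrt (by positivity)
  have h2 : √((m + 1 : ℕ) : ℝ) ^ 2 = m + 1 := by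
    rw [Real.sq_sqrt (by positivity)]
    push_cast
    rfl
  have h3 : 0 < √(m : ℝ) := Real.sqrt_pos.2 (by linarith)
  have h4 : 0 ≤ √((m + 1 : ℕ) : ℝ) := Real.sqrt_nonneg _
  have h5 : 3 / 10 * (√(m : ℝ) / m) + √(m : ℝ) ≤ √((m + 1 : ℕ) : ℝ) := by
    refine Real.le_sqrt_of_sq_le ?_
    have e1 : √(m : ℝ) / m * √(m : ℝ) = 1 := by
      rw [div_mul_eq_mul_div, ← sq, h1, div_self (by linarith)]
    have e2 : (√(m : ℝ) / m) ^ 2 ≤ 1 := by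
      rw [div_pow, h1, div_le_one (by positivity)]
      nlinarith
    push_cast
    nlinarith
  have := mul_le_mul_of_nonneg_right h5 (Real.sqrt_nonneg (p : ℝ))
  calc _ = 20 * ((3 / 10 * (√(m : ℝ) / m) + √(m : ℝ)) * √(p : ℝ)) := by ring
    _ ≤ 20 * (√((m + 1 : ℕ) : ℝ) * √(p : ℝ)) := by linarith

theorem loss_le {m k : ℕ} (hp0 : 0 < p) (hk : ((k + 1 : ℕ) : ℝ) * p ≤ 1) {α β : ℝ}
    (hα : expect (iid (coin p hp) m)
      (fun s => min 1 (((k + 1 : ℕ) : ℝ) / (1 + numTrue s))) ≤ α)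
    (hβ0 : 0 ≤ β) (hβ1 : β ≤ 1)
    (hβ : β ≤ expect (iid (coin p hp) m)
      fun s => ((k + 1 - numTrue s : ℕ) : ℝ) / (m + 1 - numTrue s)) :
    p * ((1 - α) * (1 - tailProb p hp m (k + 1))) + (1 - p) * (β * tailProb p hp m (k + 1)) +
      20 * √(m * p) ≤ 20 * √((m + 1 : ℕ) * p) := by
  -- In the last period nothing is lost: a valuable item is surely accepted, and leftover capacity
  -- is worthless.
  rcases Nat.eq_zero_or_pos m with rfl | hm
  · rw [tailProb_eq_zero p hp (by omega)]
    have h1 : 1 ≤ α := by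
      refine le_trans (le_of_eq ?_) hα
      simp [expect_iid_zero, numTrue]
    have h2 : (p : ℝ) * ((1 - α) * (1 - 0)) ≤ 0 :=
      mul_nonpos_of_nonneg_of_nonpos p.2 (by linarith)
    have h3 := Real.sqrt_nonneg (((0 + 1 : ℕ) : ℝ) * p)
    simp only [Nat.cast_zero, zero_mul, Real.sqrt_zero, mul_zero]
    linarith
  · have h1 := reject_loss_le p hp hm hp0 hα
    have h2 := accept_loss_le p hp hm hk hβ1 hβ
    have h3 : (1 - p) * (β * tailProb p hp m (k + 1)) ≤ β * tailProb p hp m (k + 1) :=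
      mul_le_of_le_one_left (mul_nonneg hβ0 (tailProb_nonneg p hp _ _))
        (sub_le_self _ p.2)
    have h4 := sqrt_step p hm
    linarith

/-- The regret of single-sample OSO, measured in the number of accepted valuable items, is of the
order of the standard deviation of the number of valuable items. -/
theorem truncMean_sub_le_oso (hσ : σ.Equivariant) (hφ0 : 0 ≤ φ) (hφ : φ < 1) (hp0 : 0 < p)
    (m : ℕ) {r : ℝ} (hr : 0 ≤ r) (hrp : r * p ≤ 1) :
    truncMean p hp m ⌊r⌋₊ - 20 * √(m * p) ≤
      policyValue p hp φ (oso σ ((coin p hp).map (coinItem φ))) m r := by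
  induction m generalizing r with
  | zero => simp [policyValue_zero, truncMean, expect_iid_zero, numTrue]
  | succ m ih =>
    rcases lt_or_ge r 1 with h1 | h1
    · rw [Nat.floor_eq_zero.2 h1, truncMean_zero_right]
      have := policyValue_nonneg p hp φ (oso σ ((coin p hp).map (coinItem φ))) hφ0 (m + 1) r
      have := Real.sqrt_nonneg (((m + 1 : ℕ) : ℝ) * p)
      linarith
    · obtain ⟨k, hk⟩ : ∃ k, ⌊r⌋₊ = k + 1 :=
        Nat.exists_eq_succ_of_ne_zero (Nat.floor_pos.2 h1).ne'
      have hα := le_decisionProb_oso p hp hσ hφ m hr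
      have hβ := decisionProb_oso_le p hp hσ hφ m hr
      have i1 := ih hr hrp
      have i2 := ih (sub_nonneg.2 h1)
        ((mul_le_mul_of_nonneg_right (sub_le_self r zero_le_one) p.2).trans hrp)
      rw [Nat.floor_sub_one, hk, Nat.add_sub_cancel] at i2
      rw [hk] at i1 hα hβ ⊢
      have hkr : ((k + 1 : ℕ) : ℝ) * p ≤ 1 := by
        refine (mul_le_mul_of_nonneg_right ?_ p.2).trans hrp
        rw [← hk]
        exact Nat.floor_le hr
      rw [policyValue_succ, truncMean_succ]
      have hα0 := decisionProb_nonneg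
        (oso σ ((coin p hp).map (coinItem φ)) m (fun _ => r) (coinItem φ true))
      have hα1 := decisionProb_le_one
        (oso σ ((coin p hp).map (coinItem φ)) m (fun _ => r) (coinItem φ true))
      have hβ0 := decisionProb_nonneg
        (oso σ ((coin p hp).map (coinItem φ)) m (fun _ => r) (coinItem φ false))
      have hβ1 := decisionProb_le_one
        (oso σ ((coin p hp).map (coinItem φ)) m (fun _ => r) (coinItem φ false))
      have hloss := loss_le p hp hp0 hkr hα hβ0 hβ1 hβ
      generalize decisionProb
        (oso σ ((coin p hp).map (coinItem φ)) m (fun _ => r) (coinItem φ true)) = α at *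
      generalize decisionProb
        (oso σ ((coin p hp).map (coinItem φ)) m (fun _ => r) (coinItem φ false)) = β at *
      have hW := truncMean_add_tailProb p hp m k
      have hp1 : (0 : ℝ) ≤ 1 - p := sub_nonneg.2 (by exact_mod_cast hp)
      generalize policyValue p hp φ (oso σ ((coin p hp).map (coinItem φ))) m r = v1 at *
      generalize policyValue p hp φ (oso σ ((coin p hp).map (coinItem φ))) m (r - 1) = v0 at *
      generalize truncMean p hp m (k + 1) = w1 at *
      generalize truncMean p hp m k = w0 at *
      generalize tailProb p hp m (k + 1) = G at *
      generalize √((m : ℝ) * p) = S at *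
      generalize √(((m + 1 : ℕ) : ℝ) * p) = S' at *
      -- Insert the induction hypothesis into both branches. With `w1 = w0 + G`, the shortfall
      -- against the benchmark recursion is `(1 - α) * (1 - G)` for a valuable item and `β * G` for
      -- a cheap one, apart from `20 * S`. The reward `φ` of cheap items is discarded.
      have j1 : α * (1 + (w0 - 20 * S)) + (1 - α) * (w1 - 20 * S) ≤
          α * (1 + v0) + (1 - α) * v1 := by
        have := mul_le_mul_of_nonneg_left i2 hα0
        have := mul_le_mul_of_nonneg_left i1 (sub_nonneg.2 hα1)
        linarith
      have j2 : β * (w0 - 20 * S) + (1 - β) * (w1 - 20 * S) ≤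
          β * (φ + v0) + (1 - β) * v1 := by
        have := mul_le_mul_of_nonneg_left i2 hβ0
        have := mul_le_mul_of_nonneg_left i1 (sub_nonneg.2 hβ1)
        have := mul_nonneg hβ0 hφ0
        linarith
      have j3 := mul_le_mul_of_nonneg_left j1 p.2
      change (p : ℝ) * _ ≤ (p : ℝ) * _ at j3
      have j4 := mul_le_mul_of_nonneg_left j2 hp1
      subst hW
      nlinarith

/-- When the capacity equals the expected number of valuable items, truncation costs at most the
mean absolute deviation, and rounding down costs at most one. -/
theorem sub_le_truncMean (m : ℕ) {r : ℝ} (hr : r = m * p) :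
    r - 1 - √r ≤ truncMean p hp m ⌊r⌋₊ := by
  have h := expect_abs_dev_le p hp m
  rw [← hr] at h
  have h2 : expect (iid (coin p hp) m) (fun s => r - 1 - |(numTrue s : ℝ) - r|) ≤
      truncMean p hp m ⌊r⌋₊ := by
    refine expect_mono _ fun s => ?_
    rw [Nat.cast_min]
    have h3 := Nat.lt_floor_add_one r
    have h4 := abs_nonneg ((numTrue s : ℝ) - r)
    have h5 := neg_abs_le ((numTrue s : ℝ) - r)
    exact le_min (by linarith) (by linarith)
  rw [expect_sub, expect_const] at h2
  linarith

end Online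

/-! ### Bounds on the hindsight optimum -/

section Optimum

variable {n : ℕ} {φ : ℝ} {b : Unit → ℝ}

theorem planReward_le_capacity (hφ : φ ≤ 1) (t : Fin n → Bool)
    {x : Fin n → Option Unit} (hx : Feasible (fun i => coinItem φ (t i)) b x) :
    planReward (fun i => coinItem φ (t i)) x ≤ b () := by
  refine le_trans ?_ ((feasible_unitItem_iff _ _ _).1 hx)
  refine (planReward_unitItem _ x).trans_le ?_
  rw [Finset.card_eq_sum_ones, Nat.cast_sum]
  refine Finset.sum_le_sum fun i _ => ?_
  cases t i <;> simp [hφ]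

theorem offlineOpt_le (hφ : φ ≤ 1) (hb : 0 ≤ b ()) (t : Fin n → Bool) :
    offlineOpt (fun i => coinItem φ (t i)) b ≤ b () := by
  obtain ⟨x, hx⟩ := exists_feasible_unitItem (fun i => cond (t i) 1 φ) hb
  refine csSup_le ⟨_, x, hx, rfl⟩ ?_
  rintro v ⟨y, hy, rfl⟩
  exact planReward_le_capacity hφ t hy

theorem le_offlineOpt (hφ : φ ≤ 1) (hb : 0 ≤ b ()) (t : Fin n → Bool) :
    ((min (numTrue t) ⌊b ()⌋₊ : ℕ) : ℝ) ≤ offlineOpt (fun i => coinItem φ (t i)) b := by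
  obtain ⟨S, hS, hcard⟩ := Finset.exists_subset_card_eq (min_le_left (numTrue t) ⌊b ()⌋₊)
  have hbdd : BddAbove {v | ∃ x, Feasible (fun i => coinItem φ (t i)) b x ∧
      planReward (fun i => coinItem φ (t i)) x = v} := by
    refine ⟨b (), ?_⟩
    rintro v ⟨y, hy, rfl⟩
    exact planReward_le_capacity hφ t hy
  refine le_csSup hbdd ⟨acceptPlan S, ?_, ?_⟩
  · refine (feasible_unitItem_iff _ _ _).2 ?_
    rw [accepted_acceptPlan, hcard]
    exact (Nat.le_floor_iff hb).1 (min_le_right _ _)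
  · refine (planReward_unitItem _ _).trans ?_
    rw [accepted_acceptPlan, ← hcard, Finset.card_eq_sum_ones, Nat.cast_sum]
    refine Finset.sum_congr rfl fun i hi => ?_
    have hti : t i = true := by simpa using hS hi
    simp [hti]

end Optimum

/-! ### The example: `p = 1 / √T`, capacity `√T` -/

section Example

variable {φ : ℝ} {T : ℕ}

theorem coe_one_div_sqrt (T : ℕ) : ((1 / NNReal.sqrt (T : ℝ≥0) : ℝ≥0) : ℝ) = 1 / √T := by
  simp

theorem example₁_expectedOPT (φ : ℝ) (T : ℕ) :
    (example₁ φ T).expectedOPT = expect (iid (coin _ (one_div_sqrt_le_one T)) T) fun t =>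
      offlineOpt (fun i => coinItem φ (t i)) fun _ => √T := by
  change mean ((iid ((coin _ (one_div_sqrt_le_one T)).map (coinItem φ)) T).map fun a =>
    offlineOpt a fun _ => √T) = _
  rw [iid_map, PMF.map_comp, mean_map]
  rfl

theorem example₁_expectedOPT_le (hφ : φ ≤ 1) (T : ℕ) :
    (example₁ φ T).expectedOPT ≤ √T := by
  rw [example₁_expectedOPT, ← expect_const (iid (coin _ (one_div_sqrt_le_one T)) T) √T]
  refine expect_mono _ fun t => ?_
  rw [expect_const]
  exact offlineOpt_le (b := fun _ => √T) hφ (Real.sqrt_nonneg _) t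

theorem truncMean_le_example₁_expectedOPT (hφ : φ ≤ 1) (T : ℕ) :
    truncMean _ (one_div_sqrt_le_one T) T ⌊√(T : ℝ)⌋₊ ≤ (example₁ φ T).expectedOPT := by
  rw [example₁_expectedOPT]
  exact expect_mono _ fun t => le_offlineOpt (b := fun _ => √T) hφ (Real.sqrt_nonneg _) t

theorem example₁_expectedOPT_nonneg (hφ : φ ≤ 1) (T : ℕ) :
    0 ≤ (example₁ φ T).expectedOPT :=
  (expect_nonneg _ fun _ => Nat.cast_nonneg _).trans (truncMean_le_example₁_expectedOPT hφ T)

theorem mul_one_div_sqrt (T : ℕ) : √(T : ℝ) = T * (1 / √T) := by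
  rw [mul_one_div, Real.div_sqrt]

theorem le_truncMean_sqrt (T : ℕ) :
    √(T : ℝ) - 1 - √√(T : ℝ) ≤ truncMean _ (one_div_sqrt_le_one T) T ⌊√(T : ℝ)⌋₊ :=
  sub_le_truncMean _ _ T (by rw [coe_one_div_sqrt, ← mul_one_div_sqrt])

/-- The relative regret bound. -/
theorem one_sub_mul_sqrt_le (hT : 1 ≤ T) :
    (1 - 22 / √√(T : ℝ)) * √(T : ℝ) ≤ √(T : ℝ) - 1 - √√(T : ℝ) - 20 * √√(T : ℝ) := by
  have h1 : 1 ≤ √√(T : ℝ) := by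
    rw [Real.one_le_sqrt, Real.one_le_sqrt]
    exact_mod_cast hT
  -- The `22` collects `20` from the regret, `1` from the deviation, and `1` from rounding, absorbed
  -- by `1 ≤ √√T`.
  have h2 : 22 / √√(T : ℝ) * √(T : ℝ) = 22 * √√(T : ℝ) := by
    rw [div_mul_eq_mul_div, mul_div_assoc, Real.div_sqrt]
  linarith

theorem le_example₁_expectedOSO (hφ0 : 0 ≤ φ) (hφ : φ < 1) (hT : 1 ≤ T) {σ : Solver Unit Unit}
    (hσ : σ.Equivariant) :
    (1 - 22 / √√(T : ℝ)) * √(T : ℝ) ≤ (example₁ φ T).expectedOSO σ := by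
  have hT' : (0 : ℝ≥0) < T := by exact_mod_cast hT
  have hs : 0 < √(T : ℝ) := Real.sqrt_pos.2 (by exact_mod_cast hT)
  have h := truncMean_sub_le_oso _ (one_div_sqrt_le_one T) hσ hφ0 hφ
    (one_div_pos.2 (NNReal.sqrt_pos.2 hT')) T (Real.sqrt_nonneg T)
    (by rw [coe_one_div_sqrt, mul_one_div_cancel hs.ne'])
  rw [coe_one_div_sqrt, ← mul_one_div_sqrt] at h
  have h2 := le_truncMean_sqrt T
  have h3 := one_sub_mul_sqrt_le hT
  exact h3.trans ((sub_le_sub_right h2 _).trans h)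

theorem le_example₁_expectedOPT (hφ : φ ≤ 1) (hT : 1 ≤ T) :
    (1 - 22 / √√(T : ℝ)) * √(T : ℝ) ≤ (example₁ φ T).expectedOPT := by
  refine le_trans ((one_sub_mul_sqrt_le hT).trans ?_)
    ((le_truncMean_sqrt T).trans (truncMean_le_example₁_expectedOPT hφ T))
  have := Real.sqrt_nonneg √(T : ℝ)
  linarith

theorem example₁_expectedMyopic (hφ0 : 0 < φ) (T : ℕ) (σ : Solver Unit Unit) :
    (example₁ φ T).expectedMyopic σ =
      (⌊√(T : ℝ)⌋₊ : ℝ) * (1 * (1 / √T) + φ * (1 - 1 / √T)) := by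
  have h := policyValue_myopic _ (one_div_sqrt_le_one T) σ hφ0 T (Real.sqrt_nonneg T)
  -- The capacity binds rather than the horizon.
  have hle : ⌊√(T : ℝ)⌋₊ ≤ T := Nat.floor_le_of_le (by
    rw [Real.sqrt_le_left (Nat.cast_nonneg T)]
    exact_mod_cast Nat.le_self_pow two_ne_zero T)
  rw [min_eq_right hle, coe_one_div_sqrt] at h
  rw [one_mul]
  exact h

theorem tendsto_sqrt_natCast : Filter.Tendsto (fun T : ℕ => √(T : ℝ)) Filter.atTop Filter.atTop :=
  Real.tendsto_sqrt_atTop.comp tendsto_natCast_atTop_atTop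

theorem tendsto_relative_regret :
    Filter.Tendsto (fun T : ℕ => 22 / √√(T : ℝ)) Filter.atTop (nhds 0) :=
  (Real.tendsto_sqrt_atTop.comp tendsto_sqrt_natCast).const_div_atTop 22

theorem tendsto_expectedOPT_div (hφ : φ ≤ 1) :
    Filter.Tendsto (fun T : ℕ => (example₁ φ T).expectedOPT / √T) Filter.atTop (nhds 1) := by
  have h : Filter.Tendsto (fun T : ℕ => 1 - 22 / √√(T : ℝ)) Filter.atTop (nhds 1) := by
    simpa using tendsto_relative_regret.const_sub 1
  refine tendsto_of_tendsto_of_tendsto_of_le_of_le' h tendsto_const_nhds ?_ ?_ <;>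
    filter_upwards [Filter.eventually_ge_atTop 1] with T hT
  · rw [le_div_iff₀ (Real.sqrt_pos.2 (by exact_mod_cast hT))]
    exact le_example₁_expectedOPT hφ hT
  · rw [div_le_one (Real.sqrt_pos.2 (by exact_mod_cast hT))]
    exact example₁_expectedOPT_le hφ T

theorem tendsto_expectedMyopic_div (hφ0 : 0 < φ) (hφ : φ ≤ 1) (σ : ℕ → Solver Unit Unit) :
    Filter.Tendsto (fun T : ℕ => (example₁ φ T).expectedMyopic (σ T) / (example₁ φ T).expectedOPT)
      Filter.atTop (nhds φ) := by
  have h1 : Filter.Tendsto (fun T : ℕ => 1 / √(T : ℝ)) Filter.atTop (nhds 0) :=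
    tendsto_sqrt_natCast.const_div_atTop 1
  have h2 : Filter.Tendsto (fun T : ℕ => (⌊√(T : ℝ)⌋₊ : ℝ) / √T) Filter.atTop (nhds 1) :=
    (tendsto_nat_floor_div_atTop (R := ℝ)).comp tendsto_sqrt_natCast
  have h3 := (h2.mul ((h1.const_mul 1).add ((h1.const_sub 1).const_mul φ))).div
    (tendsto_expectedOPT_div hφ) one_ne_zero
  simp only [mul_zero, sub_zero, mul_one, zero_add, one_mul, div_one] at h3
  refine h3.congr' ?_
  filter_upwards [Filter.eventually_ge_atTop 1] with T hT
  have hs : √(T : ℝ) ≠ 0 := (Real.sqrt_pos.2 (by exact_mod_cast hT)).ne'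
  simp only [Pi.div_apply, example₁_expectedMyopic hφ0, one_mul]
  rw [div_mul_eq_mul_div, div_div_div_cancel_right₀ hs]

theorem example₁_expectedMyopic_pos (hφ0 : 0 < φ) (hT : 1 ≤ T) (σ : Solver Unit Unit) :
    0 < (example₁ φ T).expectedMyopic σ := by
  have h1 : 1 ≤ √(T : ℝ) := by
    rw [Real.one_le_sqrt]
    exact_mod_cast hT
  have h2 : (0 : ℝ) < ⌊√(T : ℝ)⌋₊ := by exact_mod_cast Nat.floor_pos.2 h1
  have h3 : 1 / √(T : ℝ) ≤ 1 := by rw [div_le_one (by linarith)]; exact h1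
  have h4 : 0 < 1 / √(T : ℝ) := by positivity
  rw [example₁_expectedMyopic hφ0]
  refine mul_pos h2 (add_pos_of_pos_of_nonneg (by linarith) (mul_nonneg hφ0.le (by linarith)))

theorem example₁_expectedMyopic_le (hφ0 : 0 < φ) (hT : 1 ≤ T) (σ : Solver Unit Unit) :
    (example₁ φ T).expectedMyopic σ ≤ 1 + φ * √T := by
  have h1 : 0 < √(T : ℝ) := Real.sqrt_pos.2 (by exact_mod_cast hT)
  have h4 : 0 < 1 / √(T : ℝ) := by positivity
  rw [example₁_expectedMyopic hφ0]
  calc _ ≤ √(T : ℝ) * (1 / √T + φ) := by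
        have := mul_nonneg hφ0.le h4.le
        refine mul_le_mul (Nat.floor_le h1.le) (by linarith) ?_ h1.le
        have h5 : 1 / √(T : ℝ) ≤ 1 := by
          rw [div_le_one h1, Real.one_le_sqrt]
          exact_mod_cast hT
        have := mul_nonneg hφ0.le (sub_nonneg.2 h5)
        linarith
    _ = _ := by field_simp

end Example

end OnlineAllocation

open OnlineAllocation in
/-- Single-sample OSO can do unboundedly better than the myopic policy. -/
theorem proposition1 :
    -- the ratio of the expected rewards of OSO and of the myopic policy is unbounded
    (∀ M : ℝ, ∃ φ₀ : ℝ, 0 < φ₀ ∧ φ₀ ≤ 1 ∧ ∀ φ : ℝ, 0 < φ → φ < φ₀ → ∃ T₀ : ℕ, ∀ T : ℕ, T₀ ≤ T →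
      ∀ σ σ' : Solver Unit Unit, σ.Equivariant →
        0 < (example₁ φ T).expectedMyopic σ' ∧
        M * (example₁ φ T).expectedMyopic σ' ≤ (example₁ φ T).expectedOSO σ) ∧
    -- OSO is within a factor `1 - ε` of the optimum
    (∀ ε : ℝ, 0 < ε → ∃ T₀ : ℕ, ∀ T : ℕ, T₀ ≤ T → ∀ φ : ℝ, 0 < φ → φ < 1 →
      ∀ σ : Solver Unit Unit, σ.Equivariant →
        (1 - ε) * (example₁ φ T).expectedOPT ≤ (example₁ φ T).expectedOSO σ) ∧
    -- the optimum is asymptotically `√T`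
    (∀ φ : ℝ, 0 < φ → φ < 1 →
      Filter.Tendsto (fun T : ℕ => (example₁ φ T).expectedOPT / Real.sqrt T)
        Filter.atTop (nhds 1)) ∧
    -- the exact value of the myopic policy
    (∀ φ : ℝ, 0 < φ → φ < 1 → ∀ T : ℕ, ∀ σ : Solver Unit Unit,
      (example₁ φ T).expectedMyopic σ =
        (Nat.floor (Real.sqrt T) : ℝ) *
          (1 * (1 / Real.sqrt T) + φ * (1 - 1 / Real.sqrt T))) ∧
    -- the myopic policy gets asymptotically the fraction `φ` of the optimum
    (∀ φ : ℝ, 0 < φ → φ < 1 → ∀ σ : ℕ → Solver Unit Unit,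
      Filter.Tendsto
        (fun T : ℕ => (example₁ φ T).expectedMyopic (σ T) / (example₁ φ T).expectedOPT)
        Filter.atTop (nhds φ)) := by
  refine ⟨fun M => ?_, fun ε hε => ?_, fun φ h0 h1 => tendsto_expectedOPT_div h1.le,
    fun φ h0 _ T σ => example₁_expectedMyopic h0 T σ,
    fun φ h0 h1 σ => tendsto_expectedMyopic_div h0 h1.le σ⟩
  · have hM : 0 < |M| + 1 := by positivity
    -- This makes `|M| φ ≤ 1/4`. Since the myopic reward is at most `1 + φ √T`, `|M|` times it is at
    -- most `|M| + √T / 4 ≤ 3/4 √T` once `2 |M| ≤ √T`, while OSO earns at least `3/4 √T`.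
    refine ⟨min 1 (1 / (4 * (|M| + 1))), by positivity, min_le_left _ _, fun φ h0 hφ => ?_⟩
    obtain ⟨hφ1, hφM⟩ := lt_min_iff.1 hφ
    rw [lt_div_iff₀ (by positivity)] at hφM
    have hev : ∀ᶠ T : ℕ in Filter.atTop, 1 ≤ T ∧ 22 / √√(T : ℝ) < 1 / 4 ∧ 2 * |M| ≤ √(T : ℝ) :=
      (Filter.eventually_ge_atTop 1).and
        ((tendsto_relative_regret.eventually (gt_mem_nhds (by norm_num))).and
          (tendsto_sqrt_natCast.eventually_ge_atTop _))
    obtain ⟨T₀, hT₀⟩ := Filter.eventually_atTop.1 hev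
    refine ⟨T₀, fun T hT σ σ' hσ => ?_⟩
    obtain ⟨hT1, hreg, hMT⟩ := hT₀ T hT
    have hpos := example₁_expectedMyopic_pos h0 hT1 σ'
    refine ⟨hpos, ?_⟩
    have hs := Real.sqrt_nonneg (T : ℝ)
    have hmyo := mul_le_mul_of_nonneg_left (example₁_expectedMyopic_le h0 hT1 σ') (abs_nonneg M)
    have hoso := le_example₁_expectedOSO h0.le hφ1 hT1 hσ
    have e1 : M * (example₁ φ T).expectedMyopic σ' ≤ |M| * (example₁ φ T).expectedMyopic σ' :=
      mul_le_mul_of_nonneg_right (le_abs_self M) hpos.le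
    have e2 : |M| * φ * √(T : ℝ) ≤ 1 / 4 * √(T : ℝ) :=
      mul_le_mul_of_nonneg_right (by linarith) hs
    have e3 : 3 / 4 * √(T : ℝ) ≤ (1 - 22 / √√(T : ℝ)) * √(T : ℝ) :=
      mul_le_mul_of_nonneg_right (by linarith) hs
    linarith
  -- The bound by `1` keeps `1 - 22 / √√T` nonnegative when it multiplies `OPT ≤ √T`. The threshold
  -- does not involve `φ`.
  · have hev : ∀ᶠ T : ℕ in Filter.atTop, 1 ≤ T ∧ 22 / √√(T : ℝ) < min ε 1 :=
      (Filter.eventually_ge_atTop 1).and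
        (tendsto_relative_regret.eventually (gt_mem_nhds (by positivity)))
    obtain ⟨T₀, hT₀⟩ := Filter.eventually_atTop.1 hev
    refine ⟨T₀, fun T hT φ h0 h1 σ hσ => ?_⟩
    obtain ⟨hT1, hreg⟩ := hT₀ T hT
    obtain ⟨hregε, hreg1⟩ := lt_min_iff.1 hreg
    calc (1 - ε) * (example₁ φ T).expectedOPT
        ≤ (1 - 22 / √√(T : ℝ)) * (example₁ φ T).expectedOPT :=
          mul_le_mul_of_nonneg_right (by linarith) (example₁_expectedOPT_nonneg h1.le T)
      _ ≤ (1 - 22 / √√(T : ℝ)) * √(T : ℝ) :=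
          mul_le_mul_of_nonneg_left (example₁_expectedOPT_le h1.le T) (by linarith)
      _ ≤ _ := le_example₁_expectedOSO h0.le h1 hT1 hσ
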